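/- Let $(R,\mathfrak m)$ be a complete Noetherian (commutative) local ring and let $\mathcal M$ be a class of $R$-modules that is closed under submodules and quotient modules and contains all finitely generated $R$-modules. A closure operation $\mathrm{cl}$ on $\mathcal M$ assigns to every $M\in\mathcal M$ and every submodule $L\subseteq M$ a submodule $L^{\mathrm{cl}}_M$ with $L\subseteq L^{\mathrm{cl}}_M\subseteq M$, such that $(L^{\mathrm{cl}}_M)^{\mathrm{cl}}_M=L^{\mathrm{cl}}_M$, and $L^{\mathrm{cl}}_M\subseteq N^{\mathrm{cl}}_M$ whenever $L\subseteq N\subseteq M$. It is functorial if $g(L^{\mathrm{cl}}_M)\subseteq g(L)^{\mathrm{cl}}_N$ for all $R$-linear maps $g:M\to N$ in $\mathcal M$ and all $L\subseteq M$, and residual if $(\ker q)^{\mathrm{cl}}_M=q^{-1}(0^{\mathrm{cl}}_P)$ for all surjective $R$-linear maps $q:M\to P$ in $\mathcal M$. For an ideal $I$ of $R$ write $I^{\mathrm{cl}}=I^{\mathrm{cl}}_R$; $I$ is $\mathrm{cl}$-closed if $I^{\mathrm{cl}}=I$. A Noetherian local ring is Gorenstein if it has finite injective dimension as a module over itself,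 and approximately Gorenstein if it has a decreasing sequence of ideals, primary to the maximal ideal and cofinal with the powers of the maximal ideal, whose quotient rings are Gorenstein. Let $\mathrm{cl}$ be a functorial and residual closure operation on $\mathcal M$. (1) Suppose that $R$ is approximately Gorenstein and that $\{J_t\}_{t\in\mathbb N}$ is a sequence of irreducible $\mathfrak m$-primary ideals of $R$ that is cofinal with the powers of $\mathfrak m$ (for every $n$ there is $t$ with $J_t\subseteq\mathfrak m^n$) such that every $J_t$ is $\mathrm{cl}$-closed. Then $I^{\mathrm{cl}}=I$ for every ideal $I$ of $R$, and $0^{\mathrm{cl}}_M=0$ for every finitely generated $R$-module $M$. (2) Suppose that $R$ is Gorenstein and that there is a system of parameters $x_1,\dots,x_d$ of $R$ (where $d=\dim R$) such that the ideal $(x_1^t,\dots,x_d^t)$ is $\mathrm{cl}$-closed for infinitely many $t\in\mathbb N$. Then $I^{\mathrm{cl}}=I$ for every ideal $I$ of $R$, and $0^{\mathrm{cl}}_M=0$ for every finitely generated $R$-module $M$. -/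

import Mathlib

universe u

/-- A class of `R`-modules closed under taking submodules and quotient modules. -/
structure ModuleClass (R : Type u) [CommRing R] where
  /-- Membership of a module in the class. -/
  Mem : ∀ (M : Type u) [AddCommGroup M] [Module R M], Prop
  submodule : ∀ (M : Type u) [AddCommGroup M] [Module R M] (N : Submodule R M), Mem M → Mem N
  quotient : ∀ (M : Type u) [AddCommGroup M] [Module R M] (N : Submodule R M),
    Mem M → Mem (M ⧸ N)

/-- A closure operation on a class `𝓜` of modules: for every `M` in `𝓜`, an extensive,
order-preserving, idempotent operator `L ↦ L^cl_M` on the submodules of `M`.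
No compatibility between different modules `M` is part of this notion. -/
def ClosureOperation {R : Type u} [CommRing R] (𝓜 : ModuleClass R) : Type (u + 1) :=
  ∀ (M : Type u) [AddCommGroup M] [Module R M], 𝓜.Mem M → ClosureOperator (Submodule R M)

namespace ClosureOperation

variable {R : Type u} [CommRing R] {𝓜 : ModuleClass R}

/-- `cl` is functorial: `g(L^cl_M) ⊆ g(L)^cl_N` for every linear map `g : M → N` in `𝓜` and
every submodule `L` of `M`. -/
def IsFunctorial (cl : ClosureOperation 𝓜) : Prop :=
  ∀ (M N : Type u) [AddCommGroup M] [Module R M] [AddCommGroup N] [Module R N]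
    (hM : 𝓜.Mem M) (hN : 𝓜.Mem N) (g : M →ₗ[R] N) (L : Submodule R M),
    (cl M hM L).map g ≤ cl N hN (L.map g)

/-- `cl` is residual: `(ker q)^cl_M = q⁻¹(0^cl_P)` for every surjection `q : M → P` in `𝓜`. -/
def IsResidual (cl : ClosureOperation 𝓜) : Prop :=
  ∀ (M P : Type u) [AddCommGroup M] [Module R M] [AddCommGroup P] [Module R P]
    (hM : 𝓜.Mem M) (hP : 𝓜.Mem P) (q : M →ₗ[R] P), Function.Surjective q →
    cl M hM (LinearMap.ker q) = (cl P hP ⊥).comap q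

end ClosureOperation

/-- A Gorenstein local ring: a Noetherian local ring of finite injective dimension as a module
over itself. -/
structure IsGorensteinLocal (R : Type u) [CommRing R] : Prop where
  isLocalRing : IsLocalRing R
  isNoetherianRing : IsNoetherianRing R
  finite_injectiveDimension :
    ∃ n : ℕ, CategoryTheory.HasInjectiveDimensionLE (ModuleCat.of.{u} R R) n

/-- The ideal `I` of the local ring `R` is primary to the maximal ideal. -/
def IsMaxPrimary {R : Type u} [CommRing R] [IsLocalRing R] (I : Ideal R) : Prop :=
  I.IsPrimary ∧ I.radical = IsLocalRing.maximalIdeal R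

/-- An approximately Gorenstein local ring: a Noetherian local ring with a decreasing sequence of
`𝔪`-primary ideals, cofinal with the powers of `𝔪`, whose quotient rings are Gorenstein. -/
structure IsApproximatelyGorenstein (R : Type u) [CommRing R] [IsLocalRing R] : Prop where
  isNoetherianRing : IsNoetherianRing R
  exists_sequence : ∃ I : ℕ → Ideal R, Antitone I ∧
    (∀ t, IsMaxPrimary (I t) ∧ IsGorensteinLocal (R ⧸ I t)) ∧
    ∀ n : ℕ, ∃ t, I t ≤ IsLocalRing.maximalIdeal R ^ n

/-- `x₁, …, x_d` is a system of parameters of the local ring `R`: `d = dim R` and the ideal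
`(x₁, …, x_d)` has radical `𝔪`. -/
def IsSystemOfParameters {R : Type u} [CommRing R] [IsLocalRing R] {d : ℕ} (x : Fin d → R) :
    Prop :=
  ringKrullDim R = (d : WithBot ℕ∞) ∧
    (Ideal.span (Set.range x)).radical = IsLocalRing.maximalIdeal R

section SelfInjective

variable {A : Type u} [CommRing A]

/-- In a local ring whose zero ideal is irreducible, any two nonzero elements killed by the maximal
ideal are multiples of each other. -/
theorem exists_smul_eq_of_infIrred_bot [IsLocalRing A] (hA : InfIrred (⊥ : Ideal A)) {a b : A}
    (ha : a ≠ 0) (hb : b ≠ 0) (hbm : ∀ r ∈ IsLocalRing.maximalIdeal A, r * b = 0) :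
    ∃ c : A, c * a = b := by
  have h : Ideal.span {a} ⊓ Ideal.span {b} ≠ ⊥ := by
    intro h
    rcases hA.2 h with h | h <;> simp_all
  obtain ⟨z, hz, hz0⟩ := Submodule.exists_mem_ne_zero_of_ne_bot h
  obtain ⟨r, rfl⟩ := Ideal.mem_span_singleton'.mp hz.1
  obtain ⟨s, hs⟩ := Ideal.mem_span_singleton'.mp hz.2
  have hsu : IsUnit s := by
    by_contra hsu
    exact hz0 (hs ▸ hbm s ((IsLocalRing.mem_maximalIdeal s).mpr hsu))
  obtain ⟨t, ht⟩ := hsu.exists_left_inv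
  exact ⟨t * r, by rw [mul_assoc, ← hs, ← mul_assoc, ht, one_mul]⟩

theorem length_hom_le_one_of_isSimpleModule [IsLocalRing A] (hA : InfIrred (⊥ : Ideal A))
    {S : Type u} [AddCommGroup S] [Module A S] [IsSimpleModule A S] :
    Module.length A (S →ₗ[A] A) ≤ 1 := by
  have := IsSimpleModule.nontrivial A S
  obtain ⟨s, hs⟩ := exists_ne (0 : S)
  have hspan := IsSimpleModule.toSpanSingleton_surjective A (m := s) hs
  have hne {φ : S →ₗ[A] A} (hφ : φ ≠ 0) : φ s ≠ 0 := by
    intro h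
    apply hφ
    ext t
    obtain ⟨r, rfl⟩ := hspan t
    simp [h]
  have hm (r : A) (hr : r ∈ IsLocalRing.maximalIdeal A) : r • s = 0 := by
    by_contra h
    obtain ⟨c, hc⟩ := IsSimpleModule.toSpanSingleton_surjective A (m := r • s) h s
    have hu : IsUnit (1 - c * r) := by
      by_contra hu
      have := Ideal.add_mem _ ((IsLocalRing.mem_maximalIdeal _).mpr hu) (Ideal.mul_mem_left _ c hr)
      simp at this
    apply hs
    rw [← hu.smul_eq_zero]
    simp only [LinearMap.toSpanSingleton_apply] at hc
    rw [sub_smul, one_smul, mul_smul, hc, sub_self]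
  rcases subsingleton_or_nontrivial (S →ₗ[A] A) with h | h
  · simp
  · have : IsSimpleModule A (S →ₗ[A] A) := by
      rw [isSimpleModule_iff_toSpanSingleton_surjective]
      refine ⟨h, fun φ hφ ψ => ?_⟩
      by_cases hψ : ψ = 0
      · exact ⟨0, by simp [hψ]⟩
      obtain ⟨c, hc⟩ := exists_smul_eq_of_infIrred_bot hA (hne hφ) (hne hψ)
        (fun r hr => by rw [← smul_eq_mul, ← map_smul, hm r hr, map_zero])
      refine ⟨c, ?_⟩
      ext t
      obtain ⟨r, rfl⟩ := hspan t
      simp [← hc]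
    rw [Module.length_eq_one]

theorem Module.length_eq_length_ker_add_length_range {M N : Type u} [AddCommGroup M] [Module A M]
    [AddCommGroup N] [Module A N] (f : M →ₗ[A] N) :
    Module.length A M =
      Module.length A (LinearMap.ker f) + Module.length A (LinearMap.range f) :=
  Module.length_eq_add_of_exact (LinearMap.ker f).subtype f.rangeRestrict
    (Submodule.subtype_injective _) f.surjective_rangeRestrict
    (LinearMap.exact_iff.mpr (by rw [LinearMap.ker_rangeRestrict, Submodule.range_subtype]))

theorem length_ker_lcomp_subtype_le {M : Type u} [AddCommGroup M] [Module A M]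
    (N : Submodule A M) :
    Module.length A (LinearMap.ker (LinearMap.lcomp A A N.subtype)) ≤
      Module.length A ((M ⧸ N) →ₗ[A] A) := by
  refine Module.length_le_of_surjective (LinearMap.codRestrict _ (LinearMap.lcomp A A N.mkQ)
    fun φ => ?_) ?_
  · rw [LinearMap.mem_ker]
    ext x
    change φ (N.mkQ x) = 0
    rw [Submodule.mkQ_apply, (Submodule.Quotient.mk_eq_zero N).mpr x.2, map_zero]
  · rintro ⟨φ, hφ⟩
    have h : N ≤ LinearMap.ker φ := fun x hx => LinearMap.congr_fun hφ ⟨x, hx⟩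
    exact ⟨N.liftQ φ h, Subtype.ext (N.liftQ_mkQ φ h)⟩

/-- The functor `Hom(·, A)` does not increase the length of modules. -/
theorem length_hom_le_length [IsLocalRing A] (hA : InfIrred (⊥ : Ideal A))
    {M : Type u} [AddCommGroup M] [Module A M] (hM : IsFiniteLength A M) :
    Module.length A (M →ₗ[A] A) ≤ Module.length A M := by
  induction hM with
  | of_subsingleton => simp
  | @of_simple_quotient M _ _ N hS _ ih =>
    have hker : Module.length A (LinearMap.ker (LinearMap.lcomp A A N.subtype)) ≤ 1 :=
      (length_ker_lcomp_subtype_le N).trans (length_hom_le_one_of_isSimpleModule hA)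
    rw [Module.length_eq_length_ker_add_length_range (LinearMap.lcomp A A N.subtype),
      Module.length_eq_add_of_exact N.subtype N.mkQ N.subtype_injective N.mkQ_surjective
        (LinearMap.exact_subtype_mkQ N), add_comm, Module.length_eq_one A (M ⧸ N)]
    exact add_le_add ((Module.length_le_of_injective _ (Submodule.subtype_injective _)).trans ih)
      hker

/-- An Artinian local ring whose zero ideal is irreducible is self-injective. -/
theorem Module.Injective.self_of_infIrred_bot [IsLocalRing A] [IsArtinianRing A]
    (hA : InfIrred (⊥ : Ideal A)) : Module.Injective A A := by
  have hfl (M : Type u) [AddCommGroup M] [Module A M] [Module.Finite A M] : IsFiniteLength A M :=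
    isFiniteLength_iff_isNoetherian_isArtinian.mpr ⟨inferInstance, inferInstance⟩
  refine Module.Baer.injective (Module.Baer.iff_surjective.mpr fun I => ?_)
  let ρ := LinearMap.lcomp A A I.subtype
  have hker : Module.length A (LinearMap.ker ρ) ≤ Module.length A (A ⧸ I) :=
    (length_ker_lcomp_subtype_le I).trans (length_hom_le_length hA (hfl _))
  have h₁ : Module.length A (A →ₗ[A] A) = Module.length A A :=
    (LinearMap.ringLmapEquivSelf A A A).length_eq
  rw [Module.length_eq_length_ker_add_length_range ρ,
    Module.length_eq_add_of_exact I.subtype I.mkQ I.subtype_injective I.mkQ_surjective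
      (LinearMap.exact_subtype_mkQ I)] at h₁
  have hI := length_hom_le_length hA (hfl I)
  by_contra hs
  have hlt := Submodule.length_lt (R := A) (M := I →ₗ[A] A) (N := LinearMap.range ρ)
    (fun h => hs (LinearMap.range_eq_top.mp h))
  have hfin : Module.length A (A ⧸ I) ≠ ⊤ := Module.length_ne_top
  have : Module.length A (LinearMap.ker ρ) + Module.length A (LinearMap.range ρ) <
      Module.length A I + Module.length A (A ⧸ I) := by
    rw [add_comm]
    exact ((ENat.add_lt_add_iff_right (ne_top_of_le_ne_top hfin hker)).mpr (hlt.trans_le hI)).trans_le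
      (by gcongr)
  exact this.ne h₁

/-- A self-injective local ring with nonzero socle cogenerates its modules. -/
theorem Module.Injective.exists_linearMap_apply_ne_zero [IsLocalRing A] [Module.Injective A A]
    {a : A} (ha : a ≠ 0) (ham : ∀ r ∈ IsLocalRing.maximalIdeal A, r * a = 0)
    {N : Type u} [AddCommGroup N] [Module A N] {u : N} (hu : u ≠ 0) :
    ∃ φ : N →ₗ[A] A, φ u ≠ 0 := by
  let T := LinearMap.toSpanSingleton A N u
  have hT : LinearMap.ker T ≤ LinearMap.ker (LinearMap.toSpanSingleton A A a) := by
    intro r hr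
    refine ham r ((IsLocalRing.mem_maximalIdeal r).mpr fun hru => hu ?_)
    rwa [← hru.smul_eq_zero]
  obtain ⟨φ, hφ⟩ := Module.Injective.extension_property A _ _ _ ((LinearMap.ker T).liftQ T le_rfl)
    (LinearMap.ker_eq_bot.mp (Submodule.ker_liftQ_eq_bot _ _ _ le_rfl))
    ((LinearMap.ker T).liftQ _ hT)
  refine ⟨φ, ?_⟩
  have h : φ (T 1) = LinearMap.toSpanSingleton A A a 1 :=
    LinearMap.congr_fun hφ (Submodule.Quotient.mk 1)
  simp only [T, LinearMap.toSpanSingleton_apply, one_smul] at h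
  rwa [h]

end SelfInjective

section Closure

variable {R : Type u} [CommRing R] {𝓜 : ModuleClass R} {cl : ClosureOperation 𝓜}

theorem ClosureOperation.IsResidual.bot_quotient_eq_bot_iff (hres : cl.IsResidual)
    {M : Type u} [AddCommGroup M] [Module R M] (hM : 𝓜.Mem M) (L : Submodule R M)
    (hL : 𝓜.Mem (M ⧸ L)) : cl (M ⧸ L) hL ⊥ = ⊥ ↔ cl M hM L = L := by
  have h := hres M (M ⧸ L) hM hL L.mkQ L.mkQ_surjective
  rw [L.ker_mkQ] at h
  rw [h]
  constructor
  · intro h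
    rw [h, ← LinearMap.ker, L.ker_mkQ]
  · intro h
    conv_rhs at h => rw [← L.ker_mkQ, LinearMap.ker]
    exact Submodule.comap_injective_of_surjective L.mkQ_surjective h

theorem exists_ne_zero_mul_eq_zero_of_pow_maximalIdeal_eq_bot {A : Type u} [CommRing A]
    [IsLocalRing A] {n : ℕ} (hn : IsLocalRing.maximalIdeal A ^ n = ⊥) :
    ∃ a : A, a ≠ 0 ∧ ∀ r ∈ IsLocalRing.maximalIdeal A, r * a = 0 := by
  classical
  have hex : ∃ k, IsLocalRing.maximalIdeal A ^ k = ⊥ := ⟨n, hn⟩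
  obtain ⟨k, hk⟩ : ∃ k, Nat.find hex = k + 1 := by
    refine Nat.exists_eq_succ_of_ne_zero fun h0 => ?_
    have := Nat.find_spec hex
    rw [h0, pow_zero, Ideal.one_eq_top] at this
    exact top_ne_bot this
  obtain ⟨a, ha, ha0⟩ := Submodule.exists_mem_ne_zero_of_ne_bot
    (Nat.find_min hex (m := k) (by omega))
  refine ⟨a, ha0, fun r hr => ?_⟩
  have h := Nat.find_spec hex
  rw [hk, pow_succ'] at h
  exact (Submodule.mem_bot A).mp (h ▸ Ideal.mul_mem_mul hr ha)

/-- If there are arbitrarily small `𝔪`-primary `cl`-closed ideals with self-injective quotient rings,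
then `0` is `cl`-closed in every finitely generated module. -/
theorem ClosureOperation.bot_eq_bot_of_injective_quotient [IsLocalRing R] [IsNoetherianRing R]
    (hfg : ∀ (M : Type u) [AddCommGroup M] [Module R M], Module.Finite R M → 𝓜.Mem M)
    (hfun : cl.IsFunctorial) (hres : cl.IsResidual)
    (hJ : ∀ n : ℕ, ∃ J : Ideal R, J ≤ IsLocalRing.maximalIdeal R ^ n ∧
      J.radical = IsLocalRing.maximalIdeal R ∧ Module.Injective (R ⧸ J) (R ⧸ J) ∧
      cl R (hfg R inferInstance) J = J)
    (M : Type u) [AddCommGroup M] [Module R M] (hM : Module.Finite R M) :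
    cl M (hfg M hM) ⊥ = ⊥ := by
  rw [eq_bot_iff]
  intro u hu
  by_contra hu0
  obtain ⟨n, hn⟩ : ∃ n : ℕ, u ∉ (IsLocalRing.maximalIdeal R ^ n • ⊤ : Submodule R M) := by
    by_contra! h
    have h' := Ideal.iInf_pow_smul_eq_bot_of_isLocalRing (M := M) (IsLocalRing.maximalIdeal R)
      Ideal.IsPrime.ne_top'
    exact hu0 (h' ▸ (Submodule.mem_iInf _).mpr h)
  obtain ⟨J, hJn, hJrad, hJinj, hJcl⟩ := hJ n
  have hJtop : J ≠ ⊤ := by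
    rintro rfl
    rw [Ideal.radical_top] at hJrad
    exact Ideal.IsPrime.ne_top' hJrad.symm
  have : Nontrivial (R ⧸ J) := Ideal.Quotient.nontrivial_iff.mpr hJtop
  have : IsLocalRing (R ⧸ J) :=
    IsLocalRing.of_surjective' (Ideal.Quotient.mk J) Ideal.Quotient.mk_surjective
  obtain ⟨k, hk⟩ := Ideal.exists_radical_pow_le_of_fg J (IsNoetherian.noetherian _)
  have hAk : IsLocalRing.maximalIdeal (R ⧸ J) ^ k = ⊥ := by
    rw [← IsLocalRing.map_maximalIdeal_of_surjective _ Ideal.Quotient.mk_surjective,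
      ← Ideal.map_pow, ← hJrad, eq_bot_iff]
    exact (Ideal.map_mono hk).trans (Ideal.map_quotient_self J).le
  obtain ⟨a, ha, ham⟩ := exists_ne_zero_mul_eq_zero_of_pow_maximalIdeal_eq_bot hAk
  have hu' : (J • ⊤ : Submodule R M).mkQ u ≠ 0 := by
    intro h
    rw [Submodule.mkQ_apply, Submodule.Quotient.mk_eq_zero] at h
    exact hn (Submodule.smul_mono_left hJn h)
  obtain ⟨φ, hφ⟩ := Module.Injective.exists_linearMap_apply_ne_zero ha ham hu'
  have hQ : 𝓜.Mem (R ⧸ J) := hfg _ inferInstance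
  have hmem := hfun M (R ⧸ J) (hfg M hM) hQ
    (φ.restrictScalars R ∘ₗ (J • ⊤ : Submodule R M).mkQ) ⊥ ⟨u, hu, rfl⟩
  rw [Submodule.map_bot, (hres.bot_quotient_eq_bot_iff (hfg R inferInstance) J hQ).mpr hJcl] at hmem
  exact hφ hmem

end Closure

/-- The quotient of a Noetherian local ring by an irreducible `𝔪`-primary ideal is
self-injective. -/
theorem Module.Injective.quotient_of_infIrred {R : Type u} [CommRing R] [IsLocalRing R]
    [IsNoetherianRing R] {J : Ideal R} (hJ : InfIrred J)
    (hrad : J.radical = IsLocalRing.maximalIdeal R) : Module.Injective (R ⧸ J) (R ⧸ J) := by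
  have : Nontrivial (R ⧸ J) := Ideal.Quotient.nontrivial_iff.mpr hJ.ne_top
  have : IsLocalRing (R ⧸ J) :=
    IsLocalRing.of_surjective' (Ideal.Quotient.mk J) Ideal.Quotient.mk_surjective
  have hmin : IsLocalRing.maximalIdeal R ∈ J.minimalPrimes := by
    rw [← Ideal.radical_minimalPrimes, hrad, Ideal.minimalPrimes_eq_subsingleton_self]
    rfl
  have := IsLocalRing.quotient_artinian_of_mem_minimalPrimes_of_isLocalRing J hmin
  refine Module.Injective.self_of_infIrred_bot ⟨fun h => bot_ne_top h.eq_top, ?_⟩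
  intro K L hKL
  have hinj := Ideal.comap_injective_of_surjective (Ideal.Quotient.mk J) Ideal.Quotient.mk_surjective
  have hbot : Ideal.comap (Ideal.Quotient.mk J) ⊥ = J := by
    rw [← RingHom.ker_eq_comap_bot, Ideal.mk_ker]
  have h : K.comap (Ideal.Quotient.mk J) ⊓ L.comap (Ideal.Quotient.mk J) = J := by
    rw [← Ideal.comap_inf, hKL, hbot]
  exact (hJ.2 h).imp (fun h => hinj (h.trans hbot.symm)) (fun h => hinj (h.trans hbot.symm))

section FiniteInjectiveDimension

open CategoryTheory CategoryTheory.Abelian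

section InjectiveDimension

variable {R : Type u} [CommRing R]

/-- Baer's criterion in terms of `Ext`. -/
theorem Module.Injective.of_subsingleton_ext_one {M : Type u} [AddCommGroup M] [Module R M]
    (h : ∀ I : Ideal R, Subsingleton (Ext (ModuleCat.of R (R ⧸ I)) (ModuleCat.of R M) 1)) :
    Module.Injective R M := by
  refine Module.Baer.injective fun I g => ?_
  let S : ShortComplex (ModuleCat.{u} R) := ModuleCat.shortComplexOfCompEqZero I.subtype I.mkQ
    (LinearMap.exact_subtype_mkQ I).linearMap_comp_eq_zero
  have hS : S.ShortExact := ModuleCat.shortComplex_shortExact S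
    (LinearMap.exact_subtype_mkQ I) I.subtype_injective I.mkQ_surjective
  have := h I
  obtain ⟨x, hx⟩ := Ext.contravariant_sequence_exact₁ hS (ModuleCat.of R M)
    (Ext.mk₀ (ModuleCat.ofHom g)) (add_zero 1)
    (Subsingleton.elim (α := Ext (ModuleCat.of R (R ⧸ I)) (ModuleCat.of R M) 1) _ _)
  obtain ⟨φ, rfl⟩ := Ext.addEquiv₀.symm.surjective x
  refine ⟨φ.hom, fun r hr => ?_⟩
  have h₁ : S.f ≫ φ = ModuleCat.ofHom g := by
    apply Ext.addEquiv₀.symm.injective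
    simpa [Ext.mk₀_comp_mk₀] using hx
  exact LinearMap.congr_fun (ModuleCat.hom_ext_iff.mp h₁) ⟨r, hr⟩

/-- Every module embeds into an injective module. -/
theorem exists_injective_linearMap_to_injective (M : Type u) [AddCommGroup M] [Module R M] :
    ∃ (E : Type u) (_ : AddCommGroup E) (_ : Module R E) (f : M →ₗ[R] E),
      Module.Injective R E ∧ Function.Injective f := by
  obtain ⟨E, _, f, _⟩ := EnoughInjectives.presentation (ModuleCat.of R M)
  exact ⟨E, inferInstance, inferInstance, f.hom, Module.injective_module_of_injective_object R E,
    (ModuleCat.mono_iff_injective f).mp ‹_›⟩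

theorem LinearMap.shortExact_range_mkQ {M E : Type u} [AddCommGroup M] [Module R M]
    [AddCommGroup E] [Module R E] (f : M →ₗ[R] E) (hf : Function.Injective f) :
    (ModuleCat.shortComplexOfCompEqZero f (LinearMap.range f).mkQ
      (LinearMap.exact_map_mkQ_range f).linearMap_comp_eq_zero).ShortExact :=
  ModuleCat.shortComplex_shortExact _ (LinearMap.exact_map_mkQ_range f) hf
    (Submodule.mkQ_surjective _)

theorem hasInjectiveDimensionLE_of_subsingleton_ext_quotient (n : ℕ) (M : Type u) [AddCommGroup M]
    [Module R M]
    (h : ∀ I : Ideal R, Subsingleton (Ext (ModuleCat.of R (R ⧸ I)) (ModuleCat.of R M) (n + 1))) :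
    HasInjectiveDimensionLE (ModuleCat.of R M) n := by
  induction n generalizing M with
  | zero =>
    have := Module.Injective.of_subsingleton_ext_one h
    have := Module.injective_object_of_injective_module R M
    simp only [HasInjectiveDimensionLE, zero_add]
    infer_instance
  | succ n ih =>
    obtain ⟨E, _, _, f, hE, hf⟩ := exists_injective_linearMap_to_injective (R := R) M
    have hS := LinearMap.shortExact_range_mkQ f hf
    have hE' := Module.injective_object_of_injective_module R E
    rw [HasInjectiveDimensionLE, ← hS.hasInjectiveDimensionLT_X₃_iff n hE']
    refine ih _ fun I => ⟨fun x y => ?_⟩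
    have := h I
    have key (x : Ext (ModuleCat.of R (R ⧸ I)) (ModuleCat.of R (E ⧸ LinearMap.range f)) (n + 1)) :
        x = 0 := by
      obtain ⟨z, rfl⟩ := Ext.covariant_sequence_exact₃ _ hS x rfl
        (Subsingleton.elim (α := Ext (ModuleCat.of R (R ⧸ I)) (ModuleCat.of R M) (n + 1 + 1)) _ _)
      rw [Ext.eq_zero_of_injective z, Ext.zero_comp]
    rw [key x, key y]

/-- The map `R ⧸ K → R ⧸ I` given by multiplication by `a`, where `K = (I : a)`. -/
noncomputable def Ideal.mulQuotient {K I : Ideal R} {a : R} (h : ∀ r, r ∈ K ↔ r * a ∈ I) :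
    (R ⧸ K) →ₗ[R] R ⧸ I :=
  Submodule.mapQ K I (LinearMap.toSpanSingleton R R a) fun r hr => (h r).mp hr

theorem Ideal.mulQuotient_injective {K I : Ideal R} {a : R} (h : ∀ r, r ∈ K ↔ r * a ∈ I) :
    Function.Injective (Ideal.mulQuotient h) := by
  rw [← LinearMap.ker_eq_bot]
  refine Submodule.ker_liftQ_eq_bot _ _ _ fun r hr => (h r).mpr ?_
  exact (Submodule.Quotient.mk_eq_zero I).mp hr

theorem Ideal.exact_mulQuotient {K I : Ideal R} {a : R} (h : ∀ r, r ∈ K ↔ r * a ∈ I) :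
    Function.Exact (Ideal.mulQuotient h)
      (Submodule.factor (le_sup_left : I ≤ I ⊔ Ideal.span {a})) := by
  intro x
  obtain ⟨x, rfl⟩ := I.mkQ_surjective x
  constructor
  · intro hx
    have hx' : x ∈ I ⊔ Ideal.span {a} := (Submodule.Quotient.mk_eq_zero _).mp hx
    obtain ⟨i, hi, j, hj, rfl⟩ := Submodule.mem_sup.mp hx'
    obtain ⟨c, rfl⟩ := Ideal.mem_span_singleton'.mp hj
    refine ⟨K.mkQ c, ((Submodule.Quotient.eq I).mpr ?_)⟩
    simpa using hi
  · rintro ⟨y, hy⟩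
    obtain ⟨y, rfl⟩ := K.mkQ_surjective y
    rw [← hy]
    refine (Submodule.Quotient.mk_eq_zero _).mpr (Ideal.mem_sup_right ?_)
    exact Ideal.mem_span_singleton'.mpr ⟨y, rfl⟩

theorem Ideal.shortExact_mulQuotient {K I : Ideal R} {a : R} (h : ∀ r, r ∈ K ↔ r * a ∈ I) :
    (ModuleCat.shortComplexOfCompEqZero (Ideal.mulQuotient h)
      (Submodule.factor (le_sup_left : I ≤ I ⊔ Ideal.span {a}))
      (Ideal.exact_mulQuotient h).linearMap_comp_eq_zero).ShortExact :=
  ModuleCat.shortComplex_shortExact _ (Ideal.exact_mulQuotient h) (Ideal.mulQuotient_injective h)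
    (Submodule.factor_surjective le_sup_left)

theorem subsingleton_ext_quotient_of_residueField [IsLocalRing R] [IsNoetherianRing R] (n : ℕ)
    (M : Type u) [AddCommGroup M] [Module R M] [Module.Finite R M]
    [HasInjectiveDimensionLE (ModuleCat.of R M) n]
    (h : Subsingleton (Ext (ModuleCat.of R (R ⧸ IsLocalRing.maximalIdeal R)) (ModuleCat.of R M) n))
    (I : Ideal R) : Subsingleton (Ext (ModuleCat.of R (R ⧸ I)) (ModuleCat.of R M) n) := by
  induction I using IsNoetherian.induction with
  | hgt I ih =>
  change Ideal R at I
  by_cases htop : I = ⊤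
  · subst htop
    have : Subsingleton (R ⧸ (⊤ : Ideal R)) := Submodule.Quotient.subsingleton_iff.mpr rfl
    have hz := ModuleCat.isZero_of_subsingleton (ModuleCat.of R (R ⧸ (⊤ : Ideal R)))
    exact ⟨fun x y => by
      rw [← Ext.mk₀_id_comp x, ← Ext.mk₀_id_comp y, hz.eq_of_src (𝟙 _) 0]; simp⟩
  have hlt {a : R} (ha : a ∉ I) : I < I ⊔ Ideal.span {a} :=
    lt_of_le_of_ne le_sup_left fun h => ha <| by
      rw [h]; exact Ideal.mem_sup_right (Ideal.mem_span_singleton_self a)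
  by_cases hI : I.IsPrime
  · by_cases hm : I = IsLocalRing.maximalIdeal R
    · rwa [hm]
    obtain ⟨y, hym, hyI⟩ := SetLike.exists_of_lt
      (lt_of_le_of_ne (IsLocalRing.le_maximalIdeal htop) hm)
    have hK (r : R) : r ∈ I ↔ r * y ∈ I :=
      ⟨I.mul_mem_right y, fun h => (hI.mem_or_mem h).resolve_right hyI⟩
    have hS := Ideal.shortExact_mulQuotient hK
    have hsurj (x : Ext (ModuleCat.of R (R ⧸ I)) (ModuleCat.of R M) n) : ∃ z, y • z = x := by
      obtain ⟨z, hz⟩ := Ext.contravariant_sequence_exact₁ hS (ModuleCat.of R M) x (add_comm 1 n)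
        (Ext.eq_zero_of_hasInjectiveDimensionLT _ (n + 1) le_rfl)
      refine ⟨z, ?_⟩
      have hf : ModuleCat.ofHom (Ideal.mulQuotient hK) = y • 𝟙 (ModuleCat.of R (R ⧸ I)) := by
        ext
        change I.mkQ (1 * y) = y • I.mkQ 1
        rw [← map_smul, smul_eq_mul, mul_comm]
      rw [← hz]
      change _ = (Ext.mk₀ (ModuleCat.ofHom (Ideal.mulQuotient hK))).comp z _
      rw [hf, Ext.mk₀_smul, Ext.smul_comp, Ext.mk₀_id_comp]
    have htop : (⊤ : Submodule R (Ext (ModuleCat.of R (R ⧸ I)) (ModuleCat.of R M) n)) = ⊥ := by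
      refine Submodule.eq_bot_of_le_smul_of_le_jacobson_bot (IsLocalRing.maximalIdeal R) ⊤
        Module.Finite.fg_top (fun x _ => ?_) (IsLocalRing.maximalIdeal_le_jacobson _)
      obtain ⟨z, rfl⟩ := hsurj x
      exact Submodule.smul_mem_smul hym trivial
    exact (Submodule.subsingleton_iff R).mp (subsingleton_of_bot_eq_top htop.symm)
  · obtain ⟨a, ha, b, hb, hab⟩ : ∃ a, a ∉ I ∧ ∃ b, b ∉ I ∧ a * b ∈ I := by
      by_contra! hcon
      exact hI ⟨htop, fun {a b} hab => by
        by_contra! h'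
        exact hcon a h'.1 b h'.2 hab⟩
    let K : Ideal R := Submodule.comap (LinearMap.toSpanSingleton R R a) I
    have hK (r : R) : r ∈ K ↔ r * a ∈ I := Iff.rfl
    have hIK : I < K := lt_of_le_of_ne (fun r hr => I.mul_mem_right a hr)
      fun h => hb (h ▸ (hK b).mpr (mul_comm a b ▸ hab))
    have hS := Ideal.shortExact_mulQuotient hK
    have h₁ := ih K hIK
    have h₂ := ih _ (hlt ha)
    have key (x : Ext (ModuleCat.of R (R ⧸ I)) (ModuleCat.of R M) n) : x = 0 := by
      obtain ⟨z, rfl⟩ := Ext.contravariant_sequence_exact₂ hS (ModuleCat.of R M) x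
        (Subsingleton.elim (α := Ext (ModuleCat.of R (R ⧸ K)) (ModuleCat.of R M) n) _ _)
      rw [Subsingleton.elim (α := Ext (ModuleCat.of R (R ⧸ (I ⊔ Ideal.span {a})))
        (ModuleCat.of R M) n) z 0, Ext.comp_zero]
    exact ⟨fun x y => by rw [key x, key y]⟩

/-- A Noetherian local ring of depth zero and of finite injective dimension is self-injective. -/
theorem Module.Injective.self_of_hasInjectiveDimensionLE [IsLocalRing R] [IsNoetherianRing R]
    (hdepth : ∀ y ∈ IsLocalRing.maximalIdeal R, ¬ IsSMulRegular R y) (n : ℕ)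
    (h : HasInjectiveDimensionLE (ModuleCat.of R R) n) : Module.Injective R R := by
  induction n with
  | zero =>
    have : HasInjectiveDimensionLT (ModuleCat.of R R) 1 := h
    exact Module.injective_module_of_injective_object R R
  | succ n ih =>
    refine ih (hasInjectiveDimensionLE_of_subsingleton_ext_quotient n R
      (subsingleton_ext_quotient_of_residueField (n + 1) R ?_))
    obtain ⟨f, hf⟩ : ∃ f : (R ⧸ IsLocalRing.maximalIdeal R) →ₗ[R] R, Function.Injective f := by
      have hdis : Disjoint (IsLocalRing.maximalIdeal R : Set R) (nonZeroDivisors R) := by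
        rw [Set.disjoint_left]
        intro y hy hreg
        exact hdepth y hy (Module.Flat.isSMulRegular_of_nonZeroDivisors hreg)
      obtain ⟨a, ha, ha0⟩ := Submodule.exists_mem_ne_zero_of_ne_bot
        (Ideal.bot_lt_annihilator_of_disjoint_nonZeroDivisors hdis).ne'
      rw [Module.mem_annihilator] at ha
      refine ⟨(IsLocalRing.maximalIdeal R).liftQ (LinearMap.toSpanSingleton R R a) fun r hr => ?_,
        ?_⟩
      · simpa [mul_comm] using congrArg Subtype.val (ha ⟨r, hr⟩)
      · rw [← LinearMap.ker_eq_bot]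
        refine Submodule.ker_liftQ_eq_bot _ _ _ fun r hr => ?_
        refine (IsLocalRing.mem_maximalIdeal r).mpr fun hu => ha0 ?_
        rwa [← hu.smul_eq_zero]
    have hS := LinearMap.shortExact_range_mkQ f hf
    have key (x : Ext (ModuleCat.of R (R ⧸ IsLocalRing.maximalIdeal R)) (ModuleCat.of R R)
        (n + 1)) : x = 0 := by
      obtain ⟨z, rfl⟩ := Ext.contravariant_sequence_exact₁ hS (ModuleCat.of R R) x
        (add_comm 1 (n + 1)) (Ext.eq_zero_of_hasInjectiveDimensionLT _ (n + 1 + 1) le_rfl)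
      rw [Ext.eq_zero_of_projective z, Ext.comp_zero]
    exact ⟨fun x y => by rw [key x, key y]⟩

end InjectiveDimension

section TorsionBy

variable {R : Type u} [CommRing R] {y : R}

theorem Module.Injective.exists_smul_eq {E : Type u} [AddCommGroup E] [Module R E]
    [Module.Injective R E] (hy : IsSMulRegular R y) (e : E) : ∃ e' : E, y • e' = e := by
  obtain ⟨φ, hφ⟩ := Module.Injective.extension_property R _ _ _ (LinearMap.lsmul R R y) hy
    (LinearMap.toSpanSingleton R E e)
  refine ⟨φ 1, ?_⟩
  have := LinearMap.congr_fun hφ 1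
  simpa [← map_smul] using this

variable {M N : Type u} [AddCommGroup M] [Module R M] [AddCommGroup N] [Module R N]

/-- The map induced on `y`-torsion, as a linear map over `R ⧸ (y)`. -/
def LinearMap.mapTorsionBy (y : R) (g : M →ₗ[R] N) :
    Submodule.torsionBy R M y →ₗ[R ⧸ Ideal.span {y}] Submodule.torsionBy R N y where
  toFun x := ⟨g x, by
    rw [Submodule.mem_torsionBy_iff, ← map_smul, (Submodule.mem_torsionBy_iff y _).mp x.2,
      map_zero]⟩
  map_add' x z := Subtype.ext (map_add g _ _)
  map_smul' r x := by
    obtain ⟨r, rfl⟩ := Ideal.Quotient.mk_surjective r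
    exact Subtype.ext (map_smul g r x.1)

theorem Module.Injective.torsionBy [Module.Injective R M] (y : R) :
    Module.Injective (R ⧸ Ideal.span {y}) (Submodule.torsionBy R M y) where
  out X Y _ _ _ _ f hf g := by
    let _ : Module R X := Module.compHom X (Ideal.Quotient.mk (Ideal.span {y}))
    let _ : Module R Y := Module.compHom Y (Ideal.Quotient.mk (Ideal.span {y}))
    let f' : X →ₗ[R] Y :=
      { f with map_smul' := fun r x => f.map_smul (Ideal.Quotient.mk (Ideal.span {y}) r) x }
    let g' : X →ₗ[R] M :=
      { toFun := fun x => g x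
        map_add' := fun a b => by simp
        map_smul' := fun r x =>
          congrArg Subtype.val (g.map_smul (Ideal.Quotient.mk (Ideal.span {y}) r) x) }
    obtain ⟨φ, hφ⟩ := Module.Injective.extension_property R _ _ _ f' hf g'
    have hφy (z : Y) : φ z ∈ Submodule.torsionBy R M y := by
      have hz : y • z = 0 := by
        change Ideal.Quotient.mk (Ideal.span {y}) y • z = 0
        rw [Ideal.Quotient.eq_zero_iff_mem.mpr (Ideal.mem_span_singleton_self y), zero_smul]
      rw [Submodule.mem_torsionBy_iff, ← map_smul, hz, map_zero]
    refine ⟨{ toFun := fun z => ⟨φ z, hφy z⟩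
              map_add' := fun a b => Subtype.ext (map_add φ a b)
              map_smul' := fun r z => ?_ }, fun x => Subtype.ext (LinearMap.congr_fun hφ x)⟩
    obtain ⟨r, rfl⟩ := Ideal.Quotient.mk_surjective r
    exact Subtype.ext (φ.map_smul r z)

theorem LinearMap.mapTorsionBy_shortExact (f : M →ₗ[R] N) (hf : Function.Injective f)
    (hM : ∀ m : M, ∃ m', y • m' = m) :
    Function.Injective (f.mapTorsionBy y) ∧
    Function.Exact (f.mapTorsionBy y) ((LinearMap.range f).mkQ.mapTorsionBy y) ∧
    Function.Surjective ((LinearMap.range f).mkQ.mapTorsionBy y) := by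
  refine ⟨fun a b h => Subtype.ext (hf (congrArg Subtype.val h)), fun x => ⟨fun h => ?_, ?_⟩, ?_⟩
  · obtain ⟨m, hm⟩ := (Submodule.Quotient.mk_eq_zero _).mp (congrArg Subtype.val h)
    refine ⟨⟨m, ?_⟩, Subtype.ext hm⟩
    rw [Submodule.mem_torsionBy_iff]
    apply hf
    rw [map_smul, hm, map_zero, (Submodule.mem_torsionBy_iff y _).mp x.2]
  · rintro ⟨m, rfl⟩
    exact Subtype.ext ((Submodule.Quotient.mk_eq_zero _).mpr ⟨m, rfl⟩)
  · rintro ⟨c, hc⟩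
    obtain ⟨e, rfl⟩ := Submodule.mkQ_surjective _ c
    rw [Submodule.mem_torsionBy_iff, ← map_smul, Submodule.mkQ_apply,
      Submodule.Quotient.mk_eq_zero] at hc
    obtain ⟨m, hm⟩ := hc
    obtain ⟨m', rfl⟩ := hM m
    refine ⟨⟨e - f m', ?_⟩, Subtype.ext ?_⟩
    · rw [Submodule.mem_torsionBy_iff, smul_sub, ← hm, map_smul, sub_self]
    · refine (Submodule.Quotient.eq _).mpr ?_
      simp

/-- Taking `y`-torsion of a `y`-divisible module does not increase the injective dimension. -/
theorem hasInjectiveDimensionLE_torsionBy (hy : IsSMulRegular R y) (n : ℕ)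
    (hM : ∀ m : M, ∃ m', y • m' = m) (h : HasInjectiveDimensionLE (ModuleCat.of R M) n) :
    HasInjectiveDimensionLE
      (ModuleCat.of (R ⧸ Ideal.span {y}) (Submodule.torsionBy R M y)) n := by
  induction n generalizing M with
  | zero =>
    have : HasInjectiveDimensionLT (ModuleCat.of R M) 1 := h
    have := Module.injective_module_of_injective_object R M
    have := Module.Injective.torsionBy (R := R) (M := M) y
    have := Module.injective_object_of_injective_module (R ⧸ Ideal.span {y})
      (Submodule.torsionBy R M y)
    simp only [HasInjectiveDimensionLE, zero_add]
    infer_instance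
  | succ n ih =>
    obtain ⟨E, _, _, f, hE, hf⟩ := exists_injective_linearMap_to_injective (R := R) M
    have hS := LinearMap.shortExact_range_mkQ f hf
    have hE' := Module.injective_object_of_injective_module R E
    rw [HasInjectiveDimensionLE, ← hS.hasInjectiveDimensionLT_X₃_iff n hE'] at h
    obtain ⟨h₁, h₂, h₃⟩ := f.mapTorsionBy_shortExact hf hM
    have hT := ModuleCat.shortComplex_shortExact (ModuleCat.shortComplexOfCompEqZero
      (f.mapTorsionBy y) ((LinearMap.range f).mkQ.mapTorsionBy y) h₂.linearMap_comp_eq_zero)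
      h₂ h₁ h₃
    have := Module.Injective.torsionBy (R := R) (M := E) y
    have hE'' := Module.injective_object_of_injective_module (R ⧸ Ideal.span {y})
      (Submodule.torsionBy R E y)
    rw [HasInjectiveDimensionLE, ← hT.hasInjectiveDimensionLT_X₃_iff n hE'']
    refine ih (fun c => ?_) h
    obtain ⟨e, rfl⟩ := Submodule.mkQ_surjective _ c
    obtain ⟨e', rfl⟩ := Module.Injective.exists_smul_eq hy e
    exact ⟨_, (map_smul _ y e').symm⟩

/-- Dividing by a regular element lowers the injective dimension of a ring. -/
theorem hasInjectiveDimensionLE_quotient_span_singleton (hy : IsSMulRegular R y) (n : ℕ)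
    (h : HasInjectiveDimensionLE (ModuleCat.of R R) (n + 1)) :
    HasInjectiveDimensionLE
      (ModuleCat.of (R ⧸ Ideal.span {y}) (R ⧸ Ideal.span {y})) n := by
  obtain ⟨E, _, _, f, hE, hf⟩ := exists_injective_linearMap_to_injective (R := R) R
  have hS := LinearMap.shortExact_range_mkQ f hf
  have hE' := Module.injective_object_of_injective_module R E
  rw [HasInjectiveDimensionLE, ← hS.hasInjectiveDimensionLT_X₃_iff n hE'] at h
  have hdiv := Module.Injective.exists_smul_eq (E := E) hy
  have hC : HasInjectiveDimensionLE (ModuleCat.of (R ⧸ Ideal.span {y})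
      (Submodule.torsionBy R (E ⧸ LinearMap.range f) y)) n := by
    refine hasInjectiveDimensionLE_torsionBy hy n (fun c => ?_) h
    obtain ⟨e, rfl⟩ := Submodule.mkQ_surjective _ c
    obtain ⟨e', rfl⟩ := hdiv e
    exact ⟨_, (map_smul _ y e').symm⟩
  let q := (LinearMap.range f).mkQ
  have hexact (X : Type u) [AddCommGroup X] [Module R X] :
      Function.Exact (Submodule.torsionBy R X y).subtype (LinearMap.lsmul R X y) := by
    intro x
    simp
  have hmk : Function.Exact (LinearMap.lsmul R R y) (Ideal.span {y}).mkQ := by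
    intro x
    rw [Submodule.mkQ_apply, Submodule.Quotient.mk_eq_zero, Ideal.mem_span_singleton]
    exact ⟨fun ⟨c, hc⟩ => ⟨c, hc.symm⟩, fun ⟨c, hc⟩ => ⟨c, hc.symm⟩⟩
  let δ := SnakeLemma.δ' (LinearMap.lsmul R R y) (LinearMap.lsmul R E y)
    (LinearMap.lsmul R (E ⧸ LinearMap.range f) y) f q (LinearMap.exact_map_mkQ_range f) f q
    (LinearMap.exact_map_mkQ_range f) (by ext; simp [← map_smul]) (by ext; simp)
    (Submodule.torsionBy R (E ⧸ LinearMap.range f) y).subtype (hexact _) (Ideal.span {y}).mkQ hmk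
    (Submodule.mkQ_surjective _) hf
  have hδ : Function.Exact (q.mapTorsionBy y) δ :=
    SnakeLemma.exact_δ'_right _ _ _ _ _ _ _ _ _ _ _ (Submodule.torsionBy R E y).subtype
      (hexact E) _ _ _ _ _ _ ((q.mapTorsionBy y).restrictScalars R) rfl
      (Submodule.subtype_injective _)
  have hδs : Function.Surjective δ := by
    intro x
    obtain ⟨r, rfl⟩ := Submodule.mkQ_surjective _ x
    obtain ⟨e, he⟩ := hdiv (f r)
    have hqe : q e ∈ Submodule.torsionBy R (E ⧸ LinearMap.range f) y := by
      rw [Submodule.mem_torsionBy_iff, ← map_smul, he]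
      exact (Submodule.Quotient.mk_eq_zero _).mpr ⟨r, rfl⟩
    exact ⟨⟨q e, hqe⟩, SnakeLemma.δ'_eq (LinearMap.lsmul R R y) (LinearMap.lsmul R E y)
      (LinearMap.lsmul R (E ⧸ LinearMap.range f) y) f q _ f q _ _ _
      (Submodule.torsionBy R (E ⧸ LinearMap.range f) y).subtype _ (Ideal.span {y}).mkQ _ _ _
      ⟨q e, hqe⟩ e rfl r he.symm⟩
  let δ' := δ.extendScalarsOfSurjective (S := R ⧸ Ideal.span {y}) Ideal.Quotient.mk_surjective
  have hinj : Function.Injective (q.mapTorsionBy y) := by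
    rw [injective_iff_map_eq_zero]
    rintro ⟨e, he⟩ h0
    obtain ⟨r, rfl⟩ := (Submodule.Quotient.mk_eq_zero _).mp (congrArg Subtype.val h0)
    rw [Submodule.mem_torsionBy_iff, ← map_smul, map_eq_zero_iff f hf] at he
    obtain rfl : r = 0 := hy (by simpa using he)
    exact Subtype.ext (map_zero f)
  have hT := ModuleCat.shortComplex_shortExact (ModuleCat.shortComplexOfCompEqZero
    (q.mapTorsionBy y) δ' (Function.Exact.linearMap_comp_eq_zero hδ)) hδ hinj hδs
  have := Module.Injective.torsionBy (R := R) (M := E) y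
  have hE'' := Module.injective_object_of_injective_module (R ⧸ Ideal.span {y})
    (Submodule.torsionBy R E y)
  exact hT.hasInjectiveDimensionLT_X₃ (n + 1) hC
    (hasInjectiveDimensionLT_of_ge _ 1 _ (by omega))

end TorsionBy

theorem Ideal.map_mk_span_range_of_head_mem {R : Type u} [CommRing R] {d : ℕ}
    (x : Fin (d + 1) → R) {I : Ideal R}
    (hx : x 0 ∈ I) : (Ideal.span (Set.range x)).map (Ideal.Quotient.mk I) =
      Ideal.span (Set.range fun i : Fin d => Ideal.Quotient.mk I (x i.succ)) := by
  rw [Ideal.map_span, ← Set.range_comp, Fin.range_fin_succ, Function.comp_apply,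
    Ideal.Quotient.eq_zero_iff_mem.mpr hx, Ideal.span_insert_zero]
  rfl

theorem notMem_of_mem_associatedPrimes {R : Type u} [CommRing R] [IsNoetherianRing R] {y : R}
    (hreg : IsSMulRegular R y) {p : Ideal R}
    (hp : p ∈ associatedPrimes R R) : y ∉ p := by
  obtain ⟨hprime, x, hx⟩ := isAssociatedPrime_iff.mp hp
  intro hyp
  rw [hx, Submodule.mem_colon_singleton, Submodule.mem_bot] at hyp
  have hx0 : x = 0 := hreg (by simpa using hyp)
  apply hprime.ne_top
  rw [hx, hx0, Ideal.eq_top_iff_one, Submodule.mem_colon_singleton]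
  simp

section Dimension

variable {R : Type u} [CommRing R] [IsLocalRing R]

theorem IsLocalRing.radical_map_eq_maximalIdeal {A : Type u} [CommRing A] [IsLocalRing A]
    {f : R →+* A} (hf : Function.Surjective f) {I : Ideal R}
    (hI : I.radical = IsLocalRing.maximalIdeal R) :
    (I.map f).radical = IsLocalRing.maximalIdeal A := by
  have hm := IsLocalRing.map_maximalIdeal_of_surjective f hf
  refine le_antisymm ?_ ?_
  · rw [Ideal.IsPrime.radical_le_iff inferInstance, ← hm, ← hI]
    exact Ideal.map_mono Ideal.le_radical
  · rw [← hm, ← hI]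
    exact Ideal.map_radical_le f

theorem IsLocalRing.quotient {I : Ideal R} (hI : I ≠ ⊤) : IsLocalRing (R ⧸ I) :=
  have : Nontrivial (R ⧸ I) := Ideal.Quotient.nontrivial_iff.mpr hI
  IsLocalRing.of_surjective' (Ideal.Quotient.mk I) Ideal.Quotient.mk_surjective

variable [IsNoetherianRing R]

theorem ringKrullDim_le_of_radical_span_range_eq {e : ℕ} (z : Fin e → R)
    (hz : (Ideal.span (Set.range z)).radical = IsLocalRing.maximalIdeal R) :
    ringKrullDim R ≤ e := by
  have hmin : IsLocalRing.maximalIdeal R ∈ (Ideal.span (Set.range z)).minimalPrimes := by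
    rw [← Ideal.radical_minimalPrimes, hz, Ideal.minimalPrimes_eq_subsingleton_self]
    rfl
  have h := Ideal.height_le_card_of_mem_minimalPrimes_span (Set.finite_range z) hmin
  have hcard : (Set.range z).ncard ≤ e := by
    rw [← Set.image_univ]
    exact (Set.ncard_image_le Set.finite_univ).trans (by simp)
  rw [← IsLocalRing.maximalIdeal_height_eq_ringKrullDim]
  exact_mod_cast h.trans (Nat.cast_le.mpr hcard)

theorem ringKrullDim_eq_of_mem_maximalIdeal_of_isSMulRegular {y : R}
    (hy : y ∈ IsLocalRing.maximalIdeal R) (hreg : IsSMulRegular R y) :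
    ringKrullDim (R ⧸ Ideal.span {y}) + 1 = ringKrullDim R :=
  ringKrullDim_quotient_span_singleton_succ_eq_ringKrullDim_of_mem_jacobson hreg
    (by rwa [IsLocalRing.ringJacobson_eq_maximalIdeal])

theorem eq_bot_of_forall_exists_mul_eq {y : R} (hy : y ∈ IsLocalRing.maximalIdeal R) {N : Ideal R}
    (h : ∀ a ∈ N, ∃ b ∈ N, y * b = a) : N = ⊥ := by
  refine Submodule.eq_bot_of_le_smul_of_le_jacobson_bot (IsLocalRing.maximalIdeal R) N
    (IsNoetherian.noetherian N) (fun a ha => ?_) (IsLocalRing.maximalIdeal_le_jacobson _)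
  obtain ⟨b, hb, rfl⟩ := h a ha
  exact Submodule.smul_mem_smul hy hb

theorem eq_maximalIdeal_of_mem_associatedPrimes_of_injective [Module.Injective R R] {p : Ideal R}
    (hp : p ∈ associatedPrimes R R) : p = IsLocalRing.maximalIdeal R := by
  obtain ⟨hprime, x, hx⟩ := isAssociatedPrime_iff.mp hp
  by_contra hne
  obtain ⟨y, hym, hyp⟩ := SetLike.exists_of_lt
    (lt_of_le_of_ne (IsLocalRing.le_maximalIdeal hprime.ne_top) hne)
  have hK (r : R) : r ∈ p ↔ r * y ∈ p :=
    ⟨p.mul_mem_right y, fun h => (hprime.mem_or_mem h).resolve_right hyp⟩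
  let N : Ideal R := Submodule.annihilator p
  have hN : N = ⊥ := by
    refine eq_bot_of_forall_exists_mul_eq hym fun a ha => ?_
    obtain ⟨φ, hφ⟩ := Module.Injective.extension_property R _ _ _ (Ideal.mulQuotient hK)
      (Ideal.mulQuotient_injective hK) (p.liftQ (LinearMap.toSpanSingleton R R a) fun r hr => by
        simpa [mul_comm] using Submodule.mem_annihilator.mp ha r hr)
    refine ⟨φ (p.mkQ 1), Submodule.mem_annihilator.mpr fun r hr => ?_, ?_⟩
    · rw [smul_eq_mul, mul_comm, ← smul_eq_mul, ← map_smul, ← map_smul, Submodule.mkQ_apply,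
        (Submodule.Quotient.mk_eq_zero p).mpr (by simpa using hr), map_zero]
    · have h : φ (p.mkQ (1 * y)) = 1 * a := LinearMap.congr_fun hφ (p.mkQ 1)
      rw [← smul_eq_mul, ← map_smul, ← map_smul, smul_eq_mul, mul_comm, h, one_mul]
  have hxN : x ∈ N := Submodule.mem_annihilator.mpr fun r hr => by
    rw [hx, Submodule.mem_colon_singleton] at hr
    simpa [mul_comm] using hr
  rw [hN, Submodule.mem_bot] at hxN
  apply hprime.ne_top
  rw [hx, hxN, Ideal.eq_top_iff_one, Submodule.mem_colon_singleton]
  simp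

theorem ringKrullDim_eq_zero_of_injective [Module.Injective R R] : ringKrullDim R = 0 := by
  refine le_antisymm (Ring.krullDimLE_iff.mp ?_) ringKrullDim_nonneg_of_nontrivial
  refine Ring.krullDimLE_zero_iff.mpr fun q hq => ?_
  obtain ⟨p, hp, hpq⟩ := Ideal.exists_minimalPrimes_le (bot_le : ⊥ ≤ q)
  have hpa : p ∈ associatedPrimes R R :=
    Module.associatedPrimes.minimalPrimes_annihilator_subset_associatedPrimes R R
      (by rwa [Module.annihilator_eq_bot.mpr inferInstance])
  rw [eq_maximalIdeal_of_mem_associatedPrimes_of_injective hpa] at hpq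
  rw [← (IsLocalRing.maximalIdeal.isMaximal R).eq_of_le hq.ne_top hpq]
  infer_instance

/-- An associated prime `p` of `R` lies below an associated prime of `R ⧸ (y)` for a regular
element `y`. -/
theorem exists_le_comap_mem_associatedPrimes {y : R} (hy : y ∈ IsLocalRing.maximalIdeal R)
    (hreg : IsSMulRegular R y) {p : Ideal R} (hp : p ∈ associatedPrimes R R) :
    ∃ Q ∈ associatedPrimes (R ⧸ Ideal.span {y}) (R ⧸ Ideal.span {y}),
      p ≤ Q.comap (Ideal.Quotient.mk (Ideal.span {y})) := by
  obtain ⟨hprime, x, hx⟩ := isAssociatedPrime_iff.mp hp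
  obtain ⟨a, ha, hay⟩ : ∃ a ∈ Submodule.annihilator p, a ∉ Ideal.span {y} := by
    by_contra! hcon
    have hN : Submodule.annihilator p = ⊥ := by
      refine eq_bot_of_forall_exists_mul_eq hy fun a ha => ?_
      obtain ⟨c, rfl⟩ := Ideal.mem_span_singleton.mp (hcon a ha)
      refine ⟨c, Submodule.mem_annihilator.mpr fun r hr => hreg ?_, rfl⟩
      simpa [mul_assoc] using Submodule.mem_annihilator.mp ha r hr
    have hxN : x ∈ Submodule.annihilator p := Submodule.mem_annihilator.mpr fun r hr => by
      rw [hx, Submodule.mem_colon_singleton] at hr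
      simpa [mul_comm] using hr
    rw [hN, Submodule.mem_bot] at hxN
    apply hprime.ne_top
    rw [hx, hxN, Ideal.eq_top_iff_one, Submodule.mem_colon_singleton]
    simp
  obtain ⟨Q, hQ, hle⟩ := exists_le_isAssociatedPrime_of_isNoetherianRing (R ⧸ Ideal.span {y})
    (Ideal.Quotient.mk (Ideal.span {y}) a) (mt Ideal.Quotient.eq_zero_iff_mem.mp hay)
  refine ⟨Q, hQ, fun r hr => hle ?_⟩
  rw [Submodule.mem_colon_singleton, Submodule.mem_bot, smul_eq_mul, ← map_mul, mul_comm]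
  have := Submodule.mem_annihilator.mp ha r hr
  rw [smul_eq_mul] at this
  rw [this, map_zero]

end Dimension

/-- A local ring of finite injective dimension over itself is unmixed. -/
theorem ringKrullDim_le_ringKrullDim_quotient_of_mem_associatedPrimes (n : ℕ) {R : Type u}
    [CommRing R] [IsLocalRing R] [IsNoetherianRing R]
    (h : HasInjectiveDimensionLE (ModuleCat.of R R) n) {p : Ideal R}
    (hp : p ∈ associatedPrimes R R) : ringKrullDim R ≤ ringKrullDim (R ⧸ p) := by
  induction n generalizing R with
  | zero =>
    have : HasInjectiveDimensionLT (ModuleCat.of R R) 1 := h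
    have := Module.injective_module_of_injective_object R R
    have hprime : p.IsPrime := hp.1
    rw [ringKrullDim_eq_zero_of_injective]
    exact ringKrullDim_nonneg_of_nontrivial
  | succ n ih =>
    have hprime : p.IsPrime := hp.1
    by_cases hdepth : ∃ y ∈ IsLocalRing.maximalIdeal R, IsSMulRegular R y
    · obtain ⟨y, hy, hreg⟩ := hdepth
      have hytop : Ideal.span {y} ≠ ⊤ := by
        rw [Ne, Ideal.span_singleton_eq_top]
        exact (IsLocalRing.mem_maximalIdeal y).mp hy
      have := IsLocalRing.quotient hytop
      have := IsLocalRing.quotient hprime.ne_top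
      obtain ⟨Q, hQ, hpQ⟩ := exists_le_comap_mem_associatedPrimes hy hreg hp
      have hdim := ih (hasInjectiveDimensionLE_quotient_span_singleton hreg n h) hQ
      let z := Ideal.Quotient.mk p y
      have hz : z ≠ 0 := mt Ideal.Quotient.eq_zero_iff_mem.mp
        (notMem_of_mem_associatedPrimes hreg hp)
      have hzm : z ∈ IsLocalRing.maximalIdeal (R ⧸ p) := by
        rw [← IsLocalRing.map_maximalIdeal_of_surjective (Ideal.Quotient.mk p)
          Ideal.Quotient.mk_surjective]
        exact Ideal.mem_map_of_mem _ hy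
      let g : R ⧸ p →+* (R ⧸ Ideal.span {y}) ⧸ Q := Ideal.Quotient.lift p
        ((Ideal.Quotient.mk Q).comp (Ideal.Quotient.mk (Ideal.span {y})))
        fun r hr => Ideal.Quotient.eq_zero_iff_mem.mpr (hpQ hr)
      have hgz : ∀ r ∈ Ideal.span {z}, g r = 0 := by
        intro r hr
        have : Ideal.span {z} ≤ RingHom.ker g := by
          rw [Ideal.span_singleton_le_iff_mem, RingHom.mem_ker]
          change Ideal.Quotient.mk Q (Ideal.Quotient.mk (Ideal.span {y}) y) = 0
          rw [Ideal.Quotient.eq_zero_iff_mem.mpr (Ideal.mem_span_singleton_self y), map_zero]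
        exact this hr
      have hgs : Function.Surjective (Ideal.Quotient.lift (Ideal.span {z}) g hgz) :=
        Ideal.Quotient.lift_surjective_of_surjective _ _
          (Ideal.Quotient.lift_surjective_of_surjective _ _
            (Ideal.Quotient.mk_surjective.comp Ideal.Quotient.mk_surjective))
      rw [← ringKrullDim_eq_of_mem_maximalIdeal_of_isSMulRegular hy hreg,
        ← ringKrullDim_eq_of_mem_maximalIdeal_of_isSMulRegular hzm
          (Module.Flat.isSMulRegular_of_nonZeroDivisors (mem_nonZeroDivisors_of_ne_zero hz))]
      gcongr
      exact hdim.trans (ringKrullDim_le_of_surjective _ hgs)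
    · push Not at hdepth
      have := Module.Injective.self_of_hasInjectiveDimensionLE hdepth (n + 1) h
      rw [ringKrullDim_eq_zero_of_injective]
      exact ringKrullDim_nonneg_of_nontrivial

/-- A quotient of a local ring of finite injective dimension by a system of parameters is
self-injective. -/
theorem Module.Injective.of_ker_eq_span_systemOfParameters (d : ℕ) {R : Type u} [CommRing R]
    [IsLocalRing R] [IsNoetherianRing R]
    (h : ∃ n : ℕ, HasInjectiveDimensionLE (ModuleCat.of R R) n) {x : Fin d → R}
    (hx : IsSystemOfParameters x) {A : Type u} [CommRing A] {f : R →+* A}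
    (hf : Function.Surjective f) (hker : RingHom.ker f = Ideal.span (Set.range x)) :
    Module.Injective A A := by
  obtain ⟨hdim, hrad⟩ := hx
  induction d generalizing R with
  | zero =>
    obtain ⟨n, h⟩ := h
    have := Module.Injective.self_of_hasInjectiveDimensionLE (R := R) (fun y hy hreg => by
      have hytop : Ideal.span {y} ≠ ⊤ := by
        rw [Ne, Ideal.span_singleton_eq_top]
        exact (IsLocalRing.mem_maximalIdeal y).mp hy
      have := IsLocalRing.quotient hytop
      have h₁ := ringKrullDim_eq_of_mem_maximalIdeal_of_isSMulRegular hy hreg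
      have h₂ : (0 : WithBot ℕ∞) + 1 ≤ ringKrullDim (R ⧸ Ideal.span {y}) + 1 := by
        gcongr
        exact ringKrullDim_nonneg_of_nontrivial
      rw [h₁, hdim] at h₂
      exact absurd h₂ (by simp)) n h
    have hinj : Function.Injective f := by
      rw [RingHom.injective_iff_ker_eq_bot, hker, Set.range_eq_empty, Ideal.span_empty]
    let e := RingEquiv.ofBijective f ⟨hinj, hf⟩
    let _ := RingHomInvPair.of_ringEquiv e
    let _ := RingHomInvPair.of_ringEquiv e.symm
    exact Module.Injective.of_ringEquiv e
      ({ e with map_smul' := fun r s => map_mul f r s } : R ≃ₛₗ[RingHomClass.toRingHom e] A)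
  | succ d ih =>
    obtain ⟨n, h⟩ := h
    have hx0 : x 0 ∈ IsLocalRing.maximalIdeal R := by
      rw [← hrad]
      exact Ideal.le_radical (Ideal.subset_span ⟨0, rfl⟩)
    have hreg : IsSMulRegular R (x 0) := by
      apply Module.Flat.isSMulRegular_of_nonZeroDivisors
      by_contra hnz
      have hmem : x 0 ∈ ((nonZeroDivisors R : Set R))ᶜ := hnz
      rw [← biUnion_associatedPrimes_eq_compl_nonZeroDivisors, Set.mem_iUnion₂] at hmem
      obtain ⟨p, hp, hxp⟩ := hmem
      have := IsLocalRing.quotient hp.1.ne_top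
      have hle := (ringKrullDim_le_ringKrullDim_quotient_of_mem_associatedPrimes n h hp).trans
        (ringKrullDim_le_of_radical_span_range_eq
          (fun i : Fin d => Ideal.Quotient.mk p (x i.succ)) (by
            rw [← Ideal.map_mk_span_range_of_head_mem x hxp]
            exact IsLocalRing.radical_map_eq_maximalIdeal Ideal.Quotient.mk_surjective hrad))
      rw [hdim] at hle
      have : d + 1 ≤ d := by exact_mod_cast hle
      omega
    have hytop : Ideal.span {x 0} ≠ ⊤ := by
      rw [Ne, Ideal.span_singleton_eq_top]
      exact (IsLocalRing.mem_maximalIdeal _).mp hx0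
    have := IsLocalRing.quotient hytop
    have hmap := Ideal.map_mk_span_range_of_head_mem x (Ideal.mem_span_singleton_self (x 0))
    have hle : Ideal.span {x 0} ≤ RingHom.ker f := by
      rw [hker, Ideal.span_singleton_le_iff_mem]
      exact Ideal.subset_span ⟨0, rfl⟩
    refine ih (R := R ⧸ Ideal.span {x 0}) ⟨n, ?_⟩ (f := Ideal.Quotient.lift _ f fun r hr => hle hr)
      (Ideal.Quotient.lift_surjective_of_surjective _ _ hf) ?_ ?_ ?_
      (x := fun i => Ideal.Quotient.mk _ (x i.succ))
    · have : HasInjectiveDimensionLE (ModuleCat.of R R) (n + 1) :=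
        hasInjectiveDimensionLT_of_ge _ (n + 1) _ (by omega)
      exact hasInjectiveDimensionLE_quotient_span_singleton hreg n this
    · rw [← hmap, ← hker]
      exact Ideal.ker_quotient_lift f hle
    · have h₁ := ringKrullDim_eq_of_mem_maximalIdeal_of_isSMulRegular hx0 hreg
      rw [hdim] at h₁
      push_cast at h₁
      exact le_antisymm (ENat.WithBot.add_le_add_one_right_iff.mp h₁.le)
        (ENat.WithBot.add_le_add_one_right_iff.mp h₁.ge)
    · rw [← hmap]
      exact IsLocalRing.radical_map_eq_maximalIdeal Ideal.Quotient.mk_surjective hrad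

theorem IsSystemOfParameters.pow {R : Type u} [CommRing R] [IsLocalRing R] {d : ℕ} {x : Fin d → R}
    (hx : IsSystemOfParameters x) {t : ℕ} (ht : t ≠ 0) :
    IsSystemOfParameters fun i => x i ^ t := by
  refine ⟨hx.1, ?_⟩
  rw [← hx.2]
  refine le_antisymm (Ideal.radical_mono ?_) ?_
  · rw [Ideal.span_le]
    rintro _ ⟨i, rfl⟩
    exact Ideal.pow_mem_of_mem _ (Ideal.subset_span (Set.mem_range_self i)) t
      (Nat.pos_of_ne_zero ht)
  · rw [Ideal.radical_le_radical_iff, Ideal.span_le]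
    rintro _ ⟨i, rfl⟩
    exact ⟨t, Ideal.subset_span ⟨i, rfl⟩⟩

end FiniteInjectiveDimension

theorem mainTheorem6 {R : Type u} [CommRing R] [IsLocalRing R] [IsNoetherianRing R]
    [IsAdicComplete (IsLocalRing.maximalIdeal R) R]
    (𝓜 : ModuleClass R)
    (hfg : ∀ (M : Type u) [AddCommGroup M] [Module R M], Module.Finite R M → 𝓜.Mem M)
    (cl : ClosureOperation 𝓜) (hfun : cl.IsFunctorial) (hres : cl.IsResidual) :
    (IsApproximatelyGorenstein R →
      ∀ J : ℕ → Ideal R,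
        (∀ t, InfIrred (J t)) →
        (∀ t, IsMaxPrimary (J t)) →
        (∀ n : ℕ, ∃ t, J t ≤ IsLocalRing.maximalIdeal R ^ n) →
        (∀ t, cl R (hfg R inferInstance) (J t) = J t) →
        (∀ I : Ideal R, cl R (hfg R inferInstance) I = I) ∧
        (∀ (M : Type u) [AddCommGroup M] [Module R M] (hM : Module.Finite R M),
          cl M (hfg M hM) ⊥ = ⊥)) ∧
    (IsGorensteinLocal R →
      ∀ (d : ℕ) (x : Fin d → R), IsSystemOfParameters x →
        {t : ℕ | cl R (hfg R inferInstance) (Ideal.span (Set.range fun i => x i ^ t)) =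
          Ideal.span (Set.range fun i => x i ^ t)}.Infinite →
        (∀ I : Ideal R, cl R (hfg R inferInstance) I = I) ∧
        (∀ (M : Type u) [AddCommGroup M] [Module R M] (hM : Module.Finite R M),
          cl M (hfg M hM) ⊥ = ⊥)) := by
  have hideal (hM : ∀ (M : Type u) [AddCommGroup M] [Module R M] (hM : Module.Finite R M),
      cl M (hfg M hM) ⊥ = ⊥) (I : Ideal R) : cl R (hfg R inferInstance) I = I :=
    (hres.bot_quotient_eq_bot_iff _ I (hfg (R ⧸ I) inferInstance)).mp (hM (R ⧸ I) inferInstance)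
  refine ⟨fun _ J hirr hprim hcof hcl => ?_, fun hG d x hx hinf => ?_⟩
  · have key := ClosureOperation.bot_eq_bot_of_injective_quotient hfg hfun hres fun n => by
      obtain ⟨t, ht⟩ := hcof n
      exact ⟨J t, ht, (hprim t).2, Module.Injective.quotient_of_infIrred (hirr t) (hprim t).2,
        hcl t⟩
    exact ⟨hideal key, key⟩
  · have key := ClosureOperation.bot_eq_bot_of_injective_quotient hfg hfun hres fun n => by
      obtain ⟨t, ht, hnt⟩ := hinf.exists_gt n
      have hxt := hx.pow (t := t) (by omega)
      refine ⟨_, ?_, hxt.2, Module.Injective.of_ker_eq_span_systemOfParameters d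
        hG.finite_injectiveDimension hxt Ideal.Quotient.mk_surjective Ideal.mk_ker, ht⟩
      rw [Ideal.span_le]
      rintro _ ⟨i, rfl⟩
      refine Ideal.pow_le_pow_right hnt.le (Ideal.pow_mem_pow ?_ t)
      rw [← hx.2]
      exact Ideal.le_radical (Ideal.subset_span ⟨i, rfl⟩)
    exact ⟨hideal key, key⟩
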